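/- Let $N\ge 2$, let $\Omega\subset\mathbb R^N$ be a bounded open set with smooth boundary, and let $A\subset\Omega$ be a finite set. Let $f\in C(\overline\Omega)\cap C^1(\Omega\setminus A)$ be real-valued and suppose that, for some $\alpha\in(0,1)$, $$\limsup_{x\to c}\frac{|f(x)-f(c)|}{|x-c|^{\alpha}}<\infty\qquad\text{for every } c\in A .$$ Suppose moreover that $f\in W^{1,p}(\Omega)$ for some $p\in(N,\infty]$, and let $\nabla f\in L^p(\Omega)^N$ be its weak gradient, which coincides almost everywhere in $\Omega$ with the classical gradient of $f$ on $\Omega\setminus A$. Let $\omega_N$ be the area of the unit sphere of $\mathbb R^N$, let $d\sigma$ be the Euclidean surface measure, and let $\langle\cdot,\cdot\rangle$ and $|\cdot|$ be the Euclidean inner product and norm. Then for every open ball $B_R(a)=\{x\in\mathbb R^N:|x-a|<R\}\subset\Omega$ with $R>0$ and every $y\in B_R(a)$, both integrals below converge absolutely and $$f(y)=\int_{\partial B_R(a)}\frac{f(x)\,\langle x-y,\,x-a\rangle}{R\,\omega_N\,|x-y|^N}\,d\sigma(x)-\int_{B_R(a)}\frac{\langle\nabla f(x),\,x-y\rangle}{\omega_N\,|x-y|^N}\,dx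 .$$ -/

import Mathlib

open MeasureTheory Metric Set Filter Topology
open scoped ENNReal ContDiff

/-- `Ω` has smooth boundary: near each boundary point, `Ω` is the sublevel set `{ρ < 0}` of a
`C^∞` function `ρ` whose differential does not vanish at that point. -/
def HasSmoothBoundary {N : ℕ} (Ω : Set (EuclideanSpace ℝ (Fin N))) : Prop :=
  ∀ z ∈ frontier Ω, ∃ U : Set (EuclideanSpace ℝ (Fin N)), IsOpen U ∧ z ∈ U ∧
    ∃ ρ : EuclideanSpace ℝ (Fin N) → ℝ,
      ContDiffOn ℝ ∞ ρ U ∧ fderiv ℝ ρ z ≠ 0 ∧ Ω ∩ U = {x ∈ U | ρ x < 0}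

/-- `G = (g₁, …, g_N)` is a weak gradient in `L^p(Ω)` of `f`: every `gᵢ` is in `L^p(Ω)`, and
`∫_Ω f ∂φ/∂xᵢ = - ∫_Ω gᵢ φ` for every test function `φ ∈ C_c^∞(Ω)`. -/
def IsWeakGradient {N : ℕ} (Ω : Set (EuclideanSpace ℝ (Fin N))) (p : ℝ≥0∞)
    (f : EuclideanSpace ℝ (Fin N) → ℝ)
    (G : EuclideanSpace ℝ (Fin N) → EuclideanSpace ℝ (Fin N)) : Prop :=
  (∀ i : Fin N, MemLp (fun x => G x i) p (volume.restrict Ω)) ∧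
  ∀ φ : EuclideanSpace ℝ (Fin N) → ℝ,
    ContDiff ℝ ∞ φ → HasCompactSupport φ → tsupport φ ⊆ Ω →
    ∀ i : Fin N,
      ∫ x in Ω, f x * fderiv ℝ φ x (EuclideanSpace.single i 1) = - ∫ x in Ω, G x i * φ x

/-- `f` belongs to the Sobolev space `W^{1,p}(Ω)`. -/
def MemW1p {N : ℕ} (Ω : Set (EuclideanSpace ℝ (Fin N))) (p : ℝ≥0∞)
    (f : EuclideanSpace ℝ (Fin N) → ℝ) : Prop :=
  MemLp f p (volume.restrict Ω) ∧
    ∃ G : EuclideanSpace ℝ (Fin N) → EuclideanSpace ℝ (Fin N), IsWeakGradient Ω p f G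

/-- The Hölder-type condition at the points of `A`:
`limsup_{x → c} |f x - f c| / |x - c|^α < ∞` for every `c ∈ A`. The limsup is taken in `[0, ∞]`. -/
def HolderAtPoints {N : ℕ} (A : Finset (EuclideanSpace ℝ (Fin N))) (α : ℝ)
    (f : EuclideanSpace ℝ (Fin N) → ℝ) : Prop :=
  ∀ c ∈ A, limsup (fun x => ENNReal.ofReal (|f x - f c| / ‖x - c‖ ^ α)) (𝓝[≠] c) < ⊤

/-- The area `ω_N` of the unit sphere of `ℝ^N`. -/
noncomputable def unitSphereArea (N : ℕ) : ℝ :=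
  (volume : Measure (EuclideanSpace ℝ (Fin N))).toSphere.real univ

/-- The Euclidean surface measure `σ` of the sphere `∂B_R(a)` in `ℝ^N`, as a measure on `ℝ^N`
carried by this sphere: the surface measure of the unit sphere, transported by `u ↦ a + R u` and
scaled by `R^{N-1}`. -/
noncomputable def sphereMeasure {N : ℕ} (a : EuclideanSpace ℝ (Fin N)) (R : ℝ) :
    Measure (EuclideanSpace ℝ (Fin N)) :=
  ENNReal.ofReal (R ^ (N - 1)) •
    ((volume : Measure (EuclideanSpace ℝ (Fin N))).toSphere.map
      (fun u : sphere (0 : EuclideanSpace ℝ (Fin N)) 1 => a + R • (u : EuclideanSpace ℝ (Fin N))))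

/-! ### Integration over a ball along segments issuing from an off-centre point -/

section RadialCoordinates

variable {E : Type*} [NormedAddCommGroup E] [InnerProductSpace ℝ E]

/-! Sweep the ball by the segments from `y` to the sphere points `a + R v`, `|v| = 1`: put `b = y -
a`, `z = R v - b`, `x = y + s z`, `0 < s < 1`. The Jacobian is `s^(N-1) R^(N-1) (R - ⟨v, b⟩)`, and
its power of `s` cancels the singularity of the kernel, so the volume integrand becomes `W(v) ⟨∇f(y
+ s z), z⟩ / ω_N` with `W(v) = R^(N-1) (R - ⟨v, b⟩) / |z|^N`. The integral in `s` is `f(a + R v) -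
f(y)` by the fundamental theorem of calculus. Since `W` is the density of the solid angle seen from
`y`, its integral is `ω_N`; the `f(a + R v)` term is the surface integral and the other one is
`f(y)`.

Three facts make this legitimate: Hölder's inequality with `p > N` gives absolute convergence, hence
Fubini; almost every segment avoids the finite set `A` when `N ≥ 2`; the weak gradient equals the
classical one almost everywhere (`IsWeakGradient.ae_eq_gradient`). The change of variables is
`integrable_and_integral_ball_eq_integral_toSphere`. -/

theorem smul_sub_norm_smul_injective {R : ℝ} {b : E} (hb : ‖b‖ < R) :
    Function.Injective (fun x : E => R • x - ‖x‖ • b) := by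
  intro x z h
  have h1 : R • (x - z) = (‖x‖ - ‖z‖) • b := by
    simp only at h
    rw [smul_sub, sub_smul, sub_eq_sub_iff_sub_eq_sub.1 h]
  have hR : 0 < R := (norm_nonneg b).trans_lt hb
  have h2 : R * ‖x - z‖ = |‖x‖ - ‖z‖| * ‖b‖ := by
    have := congrArg norm h1
    rwa [norm_smul, norm_smul, Real.norm_of_nonneg hR.le, Real.norm_eq_abs] at this
  have h3 := abs_norm_sub_norm_le x z
  have h4 : |‖x‖ - ‖z‖| * ‖b‖ ≤ ‖x - z‖ * ‖b‖ := by gcongr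
  have h5 : ‖x - z‖ = 0 := by
    have := norm_nonneg (x - z)
    nlinarith
  exact sub_eq_zero.1 (norm_eq_zero.1 h5)

/-- In polar form the map sends `s v` to `y + s (R v - (y - a))`, so radii go to segments ending on
the sphere. It is onto because the ray from `y` through `z` leaves the ball. -/
theorem image_ball_smul_sub_norm_smul {R : ℝ} {a y : E} (hb : ‖y - a‖ < R) :
    (fun x : E => y + (R • x - ‖x‖ • (y - a))) '' (ball 0 1 \ {0}) = ball a R \ {y} := by
  have hR : 0 < R := (norm_nonneg _).trans_lt hb
  apply Subset.antisymm
  · rintro _ ⟨x, ⟨hx1, hx0⟩, rfl⟩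
    simp only [mem_ball_zero_iff] at hx1
    simp only [mem_singleton_iff] at hx0
    refine ⟨?_, ?_⟩
    · have h : y + (R • x - ‖x‖ • (y - a)) - a = R • x + (1 - ‖x‖) • (y - a) := by
        module
      rw [mem_ball_iff_norm, h]
      have h1 := norm_add_le (R • x) ((1 - ‖x‖) • (y - a))
      rw [norm_smul, norm_smul, Real.norm_of_nonneg hR.le,
        Real.norm_of_nonneg (sub_nonneg.2 hx1.le)] at h1
      nlinarith
    · simp only [mem_singleton_iff, add_eq_left]
      intro h
      apply hx0
      apply smul_sub_norm_smul_injective hb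
      simp [h]
  · rintro z ⟨hz, hzy⟩
    have hzy' : z ≠ y := hzy
    have hpos : 0 < ‖z - y‖ := norm_pos_iff.2 (sub_ne_zero.2 hzy')
    -- At the right endpoint the point is at distance at least `‖z - y‖ + 2R - ‖y - a‖ > R` from
    -- `a`, so the ray has crossed the sphere.
    have hcont : ContinuousOn (fun t : ℝ => ‖y + t • (z - y) - a‖) (Icc 1 (1 + 2 * R / ‖z - y‖)) := by
      fun_prop
    have hge : (1 : ℝ) ≤ 1 + 2 * R / ‖z - y‖ := by
      have : 0 ≤ 2 * R / ‖z - y‖ := by positivity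
      linarith
    have hmem : R ∈ Icc (‖y + (1 : ℝ) • (z - y) - a‖)
        (‖y + (1 + 2 * R / ‖z - y‖) • (z - y) - a‖) := by
      constructor
      · rw [mem_ball_iff_norm] at hz
        simpa using hz.le
      · have h1 : ‖(1 + 2 * R / ‖z - y‖) • (z - y)‖ = ‖z - y‖ + 2 * R := by
          rw [norm_smul, Real.norm_of_nonneg (by linarith)]
          field_simp
        have h2 : (1 + 2 * R / ‖z - y‖) • (z - y)
            = (y + (1 + 2 * R / ‖z - y‖) • (z - y) - a) - (y - a) := by abel
        have h3 := norm_sub_le (y + (1 + 2 * R / ‖z - y‖) • (z - y) - a) (y - a)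
        rw [← h2, h1] at h3
        linarith
    obtain ⟨t, ⟨ht1, -⟩, ht⟩ := intermediate_value_Icc hge hcont hmem
    simp only at ht
    have ht0 : 0 < t := by linarith
    have htlt : 1 < t := by
      refine lt_of_le_of_ne ht1 ?_
      rintro rfl
      rw [mem_ball_iff_norm] at hz
      rw [one_smul, add_sub_cancel] at ht
      exact hz.ne ht
    -- The preimage has the direction of the exit point and norm `t⁻¹`, since `z` lies at the
    -- fraction `t⁻¹` of the segment.
    refine ⟨(t⁻¹ * R⁻¹) • (y + t • (z - y) - a), ?_, ?_⟩
    · have hn : ‖(t⁻¹ * R⁻¹) • (y + t • (z - y) - a)‖ = t⁻¹ := by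
        rw [norm_smul, ht, Real.norm_of_nonneg (by positivity)]
        field_simp
      refine ⟨?_, ?_⟩
      · rw [mem_ball_zero_iff, hn]
        exact inv_lt_one_of_one_lt₀ htlt
      · intro h0
        rw [mem_singleton_iff] at h0
        rw [h0, norm_zero] at hn
        exact (inv_pos.2 ht0).ne hn
    · have hn : ‖(t⁻¹ * R⁻¹) • (y + t • (z - y) - a)‖ = t⁻¹ := by
        rw [norm_smul, ht, Real.norm_of_nonneg (by positivity)]
        field_simp
      simp only [hn, smul_smul]
      have : R * (t⁻¹ * R⁻¹) = t⁻¹ := by field_simp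
      rw [this]
      have h2 : t⁻¹ • (y + t • (z - y) - a) - t⁻¹ • (y - a) = (t⁻¹ * t) • (z - y) := by module
      rw [h2, inv_mul_cancel₀ ht0.ne', one_smul, add_sub_cancel]

theorem hasFDerivAt_norm_of_ne_zero {x : E} (hx : x ≠ 0) :
    HasFDerivAt (fun x : E => ‖x‖) (‖x‖⁻¹ • innerSL ℝ x) x := by
  have h := ((hasStrictFDerivAt_norm_sq x).hasFDerivAt).sqrt (by simpa using hx)
  simp only [Real.sqrt_sq (norm_nonneg _)] at h
  convert h using 1
  ext v
  simp
  field_simp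

theorem hasFDerivAt_smul_sub_norm_smul (R : ℝ) (y b : E) {x : E} (hx : x ≠ 0) :
    HasFDerivAt (fun x : E => y + (R • x - ‖x‖ • b))
      (R • ContinuousLinearMap.id ℝ E - (‖x‖⁻¹ • innerSL ℝ x).smulRight b) x := by
  have h1 : HasFDerivAt (fun x : E => R • x) (R • ContinuousLinearMap.id ℝ E) x :=
    (hasFDerivAt_id x).const_smul R
  exact (h1.sub ((hasFDerivAt_norm_of_ne_zero hx).smul_const b)).const_add y

/-- The operator is `R` times a rank-one perturbation of the identity, and `det (1 + φ ⊗ b) = 1 +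
φ(b)`. -/
theorem det_smul_id_sub_smulRight [FiniteDimensional ℝ E] {R : ℝ} (hR : R ≠ 0) (hd : 1 ≤ Module.finrank ℝ E)
    (x b : E) :
    (R • ContinuousLinearMap.id ℝ E - (‖x‖⁻¹ • innerSL ℝ x).smulRight b).det =
      R ^ (Module.finrank ℝ E - 1) * (R - inner ℝ (‖x‖⁻¹ • x) b) := by
  have h : ((R • ContinuousLinearMap.id ℝ E - (‖x‖⁻¹ • innerSL ℝ x).smulRight b : E →L[ℝ] E) :
      E →ₗ[ℝ] E) = R • LinearMap.transvection
        ((-(R⁻¹ * ‖x‖⁻¹)) • (innerSL ℝ x : E →L[ℝ] ℝ).toLinearMap) b := by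
    ext v
    simp [LinearMap.transvection, smul_smul, sub_eq_add_neg]
    field_simp
  rw [ContinuousLinearMap.det, h, LinearMap.det_smul, LinearMap.transvection.det]
  obtain ⟨k, hk⟩ := Nat.exists_eq_add_of_le' hd
  rw [hk, Nat.add_sub_cancel, pow_succ]
  simp [inner_smul_left]
  field_simp
  ring

variable [FiniteDimensional ℝ E] [MeasurableSpace E] [BorelSpace E]

theorem lintegral_ball_diff_singleton_eq_lintegral_toSphere (F : E → ℝ≥0∞) (hF : Measurable F) :
    ∫⁻ x in ball 0 1 \ {0}, F x =
      ∫⁻ v, (∫⁻ s in Ioo (0 : ℝ) 1,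
        ENNReal.ofReal (s ^ (Module.finrank ℝ E - 1)) * F (s • (v : E)))
        ∂(volume : Measure E).toSphere := by
  set G : E → ℝ≥0∞ := (ball 0 1).indicator F
  have hG : Measurable G := hF.indicator measurableSet_ball
  have h0 : ∫⁻ x in ball 0 1 \ {0}, F x = ∫⁻ x in ({0}ᶜ : Set E), G x := by
    rw [setLIntegral_indicator measurableSet_ball, sdiff_eq]
  have h1 : ∫⁻ x in ({0}ᶜ : Set E), G x = ∫⁻ x : ({0}ᶜ : Set E), G x ∂(volume.comap (Subtype.val : ({0}ᶜ : Set E) → E)) :=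
    (lintegral_subtype_comap (measurableSet_singleton (0 : E)).compl G).symm
  have hmp := (volume : Measure E).measurePreserving_homeomorphUnitSphereProd
  have h2 := hmp.symm (homeomorphUnitSphereProd E).toMeasurableEquiv
  have h3 := h2.lintegral_comp_emb (MeasurableEquiv.measurableEmbedding _)
    (fun x : ({0}ᶜ : Set E) => G x)
  rw [h0, h1, ← h3, lintegral_prod]
  · refine lintegral_congr fun v => ?_
    rw [Measure.volumeIoiPow, lintegral_withDensity_eq_lintegral_mul]
    · have h4 := lintegral_subtype_comap (μ := (volume : Measure ℝ)) (measurableSet_Ioi (a := (0 : ℝ)))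
        (fun s => ENNReal.ofReal (s ^ (Module.finrank ℝ E - 1)) * G (s • (v : E)))
      have h5 : ∫⁻ s in Ioi (0 : ℝ), ENNReal.ofReal (s ^ (Module.finrank ℝ E - 1)) * G (s • (v : E))
          = ∫⁻ s in Ioo (0 : ℝ) 1,
            ENNReal.ofReal (s ^ (Module.finrank ℝ E - 1)) * F (s • (v : E)) := by
        rw [← lintegral_indicator measurableSet_Ioi, ← lintegral_indicator measurableSet_Ioo]
        refine lintegral_congr fun s => ?_
        by_cases hs : 0 < s
        · by_cases hs1 : s < 1
          · simp [G, hs, hs1, indicator, norm_smul, abs_of_pos hs]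
          · simp [G, hs, hs1, indicator, norm_smul, abs_of_pos hs]
        · simp [hs, indicator]
      rw [← h5, ← h4]
      rfl
    · fun_prop
    · exact hG.comp (measurable_subtype_coe.comp
        ((MeasurableEquiv.measurable _).comp measurable_prodMk_left))
  · exact (hG.comp (measurable_subtype_coe.comp (MeasurableEquiv.measurable _))).aemeasurable

theorem lintegral_ball_eq_lintegral_toSphere {R : ℝ} {a y : E} (hb : ‖y - a‖ < R)
    (hd : 1 ≤ Module.finrank ℝ E) (H : E → ℝ≥0∞) (hH : Measurable H) :
    ∫⁻ x in ball a R, H x =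
      ∫⁻ v, (∫⁻ s in Ioo (0 : ℝ) 1,
        ENNReal.ofReal (s ^ (Module.finrank ℝ E - 1) *
          (R ^ (Module.finrank ℝ E - 1) * (R - inner ℝ (v : E) (y - a)))) *
            H (y + s • (R • (v : E) - (y - a))))
        ∂(volume : Measure E).toSphere := by
  have hR : 0 < R := (norm_nonneg _).trans_lt hb
  have : Nontrivial E := Module.nontrivial_of_finrank_pos (R := ℝ) hd
  have h1 : ∫⁻ x in ball a R, H x = ∫⁻ x in ball a R \ {y}, H x := by
    refine setLIntegral_congr ?_
    exact (sdiff_null_ae_eq_self (measure_singleton y)).symm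
  rw [h1, ← image_ball_smul_sub_norm_smul hb,
    lintegral_image_eq_lintegral_abs_det_fderiv_mul volume
      (measurableSet_ball.diff (measurableSet_singleton _))
      (fun x hx => (hasFDerivAt_smul_sub_norm_smul R y (y - a) hx.2).hasFDerivWithinAt)
      (fun x _ z _ h => smul_sub_norm_smul_injective hb (add_left_cancel h))]
  simp only [det_smul_id_sub_smulRight hR.ne' hd]
  rw [lintegral_ball_diff_singleton_eq_lintegral_toSphere]
  · refine lintegral_congr fun v => setLIntegral_congr_fun measurableSet_Ioo fun s hs => ?_
    have hv : ‖(v : E)‖ = 1 := by simp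
    have hn : ‖s • (v : E)‖ = s := by rw [norm_smul, hv, mul_one, Real.norm_of_nonneg hs.1.le]
    have hpos : 0 ≤ R - inner ℝ (v : E) (y - a) := by
      have := real_inner_le_norm (v : E) (y - a)
      rw [hv, one_mul] at this
      linarith
    simp only [hn, smul_smul, inv_mul_cancel₀ hs.1.ne', one_smul]
    rw [abs_of_nonneg (by positivity), ENNReal.ofReal_mul (pow_nonneg hs.1.le _), mul_assoc]
    congr 4
    module
  · refine Measurable.mul ?_ (hH.comp (by fun_prop))
    refine ENNReal.measurable_ofReal.comp ?_
    have : Measurable fun x : E => |R ^ (Module.finrank ℝ E - 1) *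
        (R - inner ℝ (‖x‖⁻¹ • x) (y - a))| := by
      have : Measurable fun x : E => ‖x‖⁻¹ • x := by fun_prop
      have h2 : Measurable fun x : E => inner ℝ (‖x‖⁻¹ • x) (y - a) := this.inner_const
      have h3 : Measurable fun x : E => R ^ (Module.finrank ℝ E - 1) *
        (R - inner ℝ (‖x‖⁻¹ • x) (y - a)) := (measurable_const.sub h2).const_mul _
      exact h3.abs
    exact this

/-- As an identity of measures, the change of variables passes to signed integrands that are only
a.e. measurable, and carries integrability with it. -/
theorem map_withDensity_toSphere_prod_eq_restrict_ball {R : ℝ} {a y : E} (hb : ‖y - a‖ < R)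
    (hd : 1 ≤ Module.finrank ℝ E) :
    (((volume : Measure E).toSphere.prod (volume.restrict (Ioo (0 : ℝ) 1))).withDensity
      fun p => ENNReal.ofReal (p.2 ^ (Module.finrank ℝ E - 1) *
          (R ^ (Module.finrank ℝ E - 1) * (R - inner ℝ (p.1 : E) (y - a))))).map
        (fun p => y + p.2 • (R • (p.1 : E) - (y - a))) = volume.restrict (ball a R) := by
  have hT : Measurable fun p : sphere (0 : E) 1 × ℝ => y + p.2 • (R • (p.1 : E) - (y - a)) := by
    fun_prop
  have hJ : Measurable fun p : sphere (0 : E) 1 × ℝ =>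
      ENNReal.ofReal (p.2 ^ (Module.finrank ℝ E - 1) *
          (R ^ (Module.finrank ℝ E - 1) * (R - inner ℝ (p.1 : E) (y - a)))) := by
    fun_prop
  refine Measure.ext_of_lintegral _ fun H hH => ?_
  rw [lintegral_map hH hT]
  erw [lintegral_withDensity_eq_lintegral_mul _ hJ (hH.comp hT)]
  rw [lintegral_prod _ (hJ.mul (hH.comp hT)).aemeasurable,
    lintegral_ball_eq_lintegral_toSphere hb hd H hH]
  rfl

theorem integrable_and_integral_ball_eq_integral_toSphere {R : ℝ} {a y : E} (hb : ‖y - a‖ < R)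
    (hd : 1 ≤ Module.finrank ℝ E) (g : E → ℝ) (hg : IntegrableOn g (ball a R)) :
    Integrable (fun p : sphere (0 : E) 1 × ℝ => p.2 ^ (Module.finrank ℝ E - 1) *
          (R ^ (Module.finrank ℝ E - 1) * (R - inner ℝ (p.1 : E) (y - a))) *
          g (y + p.2 • (R • (p.1 : E) - (y - a))))
      ((volume : Measure E).toSphere.prod (volume.restrict (Ioo (0 : ℝ) 1))) ∧
    ∫ x in ball a R, g x = ∫ p : sphere (0 : E) 1 × ℝ, p.2 ^ (Module.finrank ℝ E - 1) *
          (R ^ (Module.finrank ℝ E - 1) * (R - inner ℝ (p.1 : E) (y - a))) *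
          g (y + p.2 • (R • (p.1 : E) - (y - a)))
      ∂((volume : Measure E).toSphere.prod (volume.restrict (Ioo (0 : ℝ) 1))) := by
  have hR : 0 < R := (norm_nonneg _).trans_lt hb
  have hT : Measurable fun p : sphere (0 : E) 1 × ℝ => y + p.2 • (R • (p.1 : E) - (y - a)) := by
    fun_prop
  have hJ : Measurable fun p : sphere (0 : E) 1 × ℝ =>
      ENNReal.ofReal (p.2 ^ (Module.finrank ℝ E - 1) *
          (R ^ (Module.finrank ℝ E - 1) * (R - inner ℝ (p.1 : E) (y - a)))) := by
    fun_prop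
  have hpos : ∀ᵐ p ∂((volume : Measure E).toSphere.prod (volume.restrict (Ioo (0 : ℝ) 1))),
      0 ≤ p.2 ^ (Module.finrank ℝ E - 1) *
          (R ^ (Module.finrank ℝ E - 1) * (R - inner ℝ (p.1 : E) (y - a))) := by
    have h := Measure.quasiMeasurePreserving_snd (μ := (volume : Measure E).toSphere)
      (ν := volume.restrict (Ioo (0 : ℝ) 1)) |>.ae (ae_restrict_mem measurableSet_Ioo)
    filter_upwards [h] with p hp
    have := real_inner_le_norm (p.1 : E) (y - a)
    rw [norm_eq_of_mem_sphere, one_mul] at this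
    have h1 : 0 ≤ R - inner ℝ (p.1 : E) (y - a) := by linarith
    have h2 := hp.1.le
    positivity
  have hmap := map_withDensity_toSphere_prod_eq_restrict_ball hb hd
  rw [IntegrableOn, ← hmap] at hg
  have hgm := hg.aestronglyMeasurable
  constructor
  · have h1 := (integrable_map_measure hgm hT.aemeasurable).1 hg
    rw [integrable_withDensity_iff_integrable_smul' hJ (by simp)] at h1
    refine h1.congr ?_
    filter_upwards [hpos] with p hp
    simp [ENNReal.toReal_ofReal hp]
  · rw [← hmap, integral_map hT.aemeasurable hgm,
      integral_withDensity_eq_integral_toReal_smul hJ (by simp)]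
    refine integral_congr_ae ?_
    filter_upwards [hpos] with p hp
    simp [ENNReal.toReal_ofReal hp]

end RadialCoordinates

/-! ### Null points and the solid-angle weight on the sphere -/

section SphereWeights

variable {E : Type*} [NormedAddCommGroup E] [InnerProductSpace ℝ E] [FiniteDimensional ℝ E]
  [MeasurableSpace E] [BorelSpace E]

/-- The cone over a point lies in a line, a proper subspace in dimension at least 2. -/
theorem toSphere_singleton (hd : 2 ≤ Module.finrank ℝ E) (v : sphere (0 : E) 1) :
    (volume : Measure E).toSphere {v} = 0 := by
  rw [Measure.toSphere_apply' _ (measurableSet_singleton v)]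
  refine mul_eq_zero_of_right _ (measure_mono_null (t := (Submodule.span ℝ {(v : E)} : Set E)) ?_ ?_)
  · rintro _ ⟨s, -, _, ⟨w, hw, rfl⟩, rfl⟩
    rw [mem_singleton_iff.1 hw]
    exact Submodule.smul_mem _ _ (Submodule.mem_span_singleton_self _)
  · refine Measure.addHaar_submodule _ _ fun h => ?_
    have h1 := finrank_span_singleton (K := ℝ) (ne_zero_of_mem_unit_sphere v)
    rw [h, finrank_top] at h1
    omega

omit [FiniteDimensional ℝ E] [MeasurableSpace E] [BorelSpace E] in
theorem sub_norm_le_norm_smul_sub {R : ℝ} (hR : 0 ≤ R) (b : E) (v : sphere (0 : E) 1) :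
    R - ‖b‖ ≤ ‖R • (v : E) - b‖ := by
  have := norm_sub_norm_le (R • (v : E)) b
  rwa [norm_smul, norm_eq_of_mem_sphere, mul_one, Real.norm_of_nonneg hR] at this

/-- The change of variables is tested on the indicator of the ball of radius `R - ‖b‖` about `b`,
whose volume is known and which every segment from `b` meets in an initial piece. -/
theorem integral_toSphere_poisson_weight {R : ℝ} {b : E} (hb : ‖b‖ < R)
    (hd : 1 ≤ Module.finrank ℝ E) :
    ∫ v, R ^ (Module.finrank ℝ E - 1) * (R - inner ℝ (v : E) b) /
        ‖R • (v : E) - b‖ ^ Module.finrank ℝ E ∂(volume : Measure E).toSphere =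
      (volume : Measure E).toSphere.real univ := by
  have hR : 0 < R := (norm_nonneg _).trans_lt hb
  have : Nontrivial E := Module.nontrivial_of_finrank_pos (R := ℝ) hd
  set ε := R - ‖b‖ with hε
  have hε0 : 0 < ε := sub_pos.2 hb
  set n := Module.finrank ℝ E with hn
  have hn0 : (n : ℝ) ≠ 0 := by positivity
  have hb' : ‖b - 0‖ < R := by rwa [sub_zero]
  have hsub : ball b ε ⊆ ball 0 R := ball_subset_ball' (by simp [hε])
  obtain ⟨hi, he⟩ := integrable_and_integral_ball_eq_integral_toSphere hb' hd
    ((ball b ε).indicator fun _ => (1 : ℝ))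
    ((integrable_indicator_iff measurableSet_ball).2 (integrableOn_const measure_ball_lt_top.ne)).integrableOn
  rw [integral_prod _ hi, setIntegral_indicator measurableSet_ball,
    inter_eq_self_of_subset_right hsub, setIntegral_const, smul_eq_mul, mul_one] at he
  -- The segment stays in the small ball exactly for `s < ε / d`, and integrating `s^(n-1)` up to
  -- there produces the factor `d^(-n)` of the weight.
  have hinner : ∀ v : sphere (0 : E) 1,
      ∫ s in Ioo (0 : ℝ) 1, s ^ (n - 1) * (R ^ (n - 1) * (R - inner ℝ (v : E) (b - 0))) *
        (ball b ε).indicator (fun _ => (1 : ℝ)) (b + s • (R • (v : E) - (b - 0))) =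
      ε ^ n / n * (R ^ (n - 1) * (R - inner ℝ (v : E) b) / ‖R • (v : E) - b‖ ^ n) := by
    intro v
    set d := ‖R • (v : E) - b‖ with hdd
    have hle : ε ≤ d := sub_norm_le_norm_smul_sub hR.le b v
    have hd0 : 0 < d := hε0.trans_le hle
    have hle1 : ε / d ≤ 1 := (div_le_one hd0).2 hle
    have h1 : ∀ s ∈ Ioo (0 : ℝ) 1, s ^ (n - 1) * (R ^ (n - 1) * (R - inner ℝ (v : E) (b - 0))) *
        (ball b ε).indicator (fun _ => (1 : ℝ)) (b + s • (R • (v : E) - (b - 0))) =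
        (Ioo 0 (ε / d)).indicator
          (fun s => s ^ (n - 1) * (R ^ (n - 1) * (R - inner ℝ (v : E) b))) s := by
      intro s hs
      have hiff : b + s • (R • (v : E) - b) ∈ ball b ε ↔ s ∈ Ioo 0 (ε / d) := by
        rw [mem_ball_iff_norm, add_sub_cancel_left, norm_smul, Real.norm_of_nonneg hs.1.le,
          ← hdd, mem_Ioo, lt_div_iff₀ hd0]
        simp [hs.1]
      rw [sub_zero]
      by_cases h : s ∈ Ioo 0 (ε / d)
      · rw [indicator_of_mem h, indicator_of_mem (hiff.2 h), mul_one]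
      · rw [indicator_of_notMem h, indicator_of_notMem (mt hiff.1 h), mul_zero]
    rw [setIntegral_congr_fun measurableSet_Ioo h1, setIntegral_indicator measurableSet_Ioo,
      inter_eq_self_of_subset_right (Ioo_subset_Ioo_right hle1), ← integral_Ioc_eq_integral_Ioo,
      ← intervalIntegral.integral_of_le (by positivity), intervalIntegral.integral_mul_const,
      integral_pow]
    have hsucc : n - 1 + 1 = n := Nat.sub_add_cancel hd
    have hcast : ((n - 1 : ℕ) : ℝ) + 1 = n := by exact_mod_cast hsucc
    rw [hsucc, hcast, zero_pow (by omega), sub_zero, div_pow]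
    field_simp
  simp only [← hn, hinner] at he
  rw [integral_const_mul, measureReal_def, Measure.addHaar_ball _ _ hε0.le, ENNReal.toReal_mul,
    ENNReal.toReal_ofReal (by positivity), ← measureReal_def, ← hn] at he
  rw [Measure.toSphere_real_apply_univ, ← hn]
  have hεn : ε ^ n ≠ 0 := by positivity
  field_simp at he
  linarith

end SphereWeights

/-! ### Integrability of the singular kernel -/

section Kernel

variable {N : ℕ}

theorem memLp_coord_div_norm_pow (hN : 1 ≤ N) (i : Fin N) (y a : EuclideanSpace ℝ (Fin N)) (c R q : ℝ)
    (hq0 : 0 < q) (hq : (N - 1 : ℝ) * q < N) :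
    MemLp (fun x : EuclideanSpace ℝ (Fin N) => (x - y) i / (c * ‖x - y‖ ^ N)) (ENNReal.ofReal q)
      (volume.restrict (ball a R)) := by
  set k : EuclideanSpace ℝ (Fin N) → ℝ := fun x => x i / (c * ‖x‖ ^ N) with hk
  have hkm : Measurable k := by fun_prop
  have hbound : ∀ x, ‖‖k x‖ ^ q‖ ≤ |c|⁻¹ ^ q * ‖x‖ ^ (-((N - 1 : ℝ) * q)) := by
    intro x
    rw [Real.norm_of_nonneg (by positivity)]
    rcases eq_or_ne x 0 with rfl | hx
    · simp only [hk, PiLp.zero_apply, zero_div, norm_zero, Real.zero_rpow hq0.ne']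
      positivity
    have hx0 : 0 < ‖x‖ := norm_pos_iff.2 hx
    have h1 : ‖k x‖ ≤ |c|⁻¹ * ‖x‖ ^ (-(N - 1 : ℝ)) := by
      have h2 : ‖x i‖ ≤ ‖x‖ := PiLp.norm_apply_le x i
      have h3 : ‖x‖ ^ (-(N - 1 : ℝ)) = ‖x‖ / ‖x‖ ^ N := by
        rw [neg_sub, Real.rpow_sub hx0, Real.rpow_one, Real.rpow_natCast]
      rw [h3]
      simp only [hk, norm_div, norm_mul, norm_pow, norm_norm, Real.norm_eq_abs c]
      rw [mul_comm |c|, ← div_div, div_eq_mul_inv _ |c|, mul_comm]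
      gcongr
    calc ‖k x‖ ^ q ≤ (|c|⁻¹ * ‖x‖ ^ (-(N - 1 : ℝ))) ^ q := by gcongr
      _ = _ := by
        rw [Real.mul_rpow (by positivity) (by positivity), ← Real.rpow_mul hx0.le]
        ring_nf
  -- The radius is chosen so that this ball contains the translate of `ball a R` by `-y`.
  have hint : IntegrableOn (fun x => ‖k x‖ ^ q) (ball 0 (R + dist a y)) := by
    refine integrableOn_ball_of_norm_le_rpow (by simpa using hN) (by simpa using hq)
      (ae_of_all _ hbound) ?_
    exact (hkm.norm.pow_const q).aestronglyMeasurable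
  have hmp := measurePreserving_sub_right (volume : Measure (EuclideanSpace ℝ (Fin N))) y
  have hint2 := (hmp.integrableOn_comp_preimage
    (MeasurableEquiv.subRight y).measurableEmbedding).2 hint
  have hsub : ball a R ⊆ (fun x => x - y) ⁻¹' ball 0 (R + dist a y) := by
    intro x hx
    rw [mem_preimage, mem_ball_zero_iff, ← dist_eq_norm]
    rw [mem_ball] at hx
    linarith [dist_triangle x a y]
  have hint3 := hint2.mono_set hsub
  rw [← integrable_norm_rpow_iff _ (by simpa using hq0) ENNReal.ofReal_ne_top,
    ENNReal.toReal_ofReal hq0.le]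
  · exact hint3
  · exact (hkm.comp (by fun_prop : Measurable fun x => x - y)).aestronglyMeasurable

/-- Hölder's inequality with a finite exponent `r` strictly between `N` and `p` (which may be
infinite): `(N - 1) r / (r - 1) < N` is equivalent to `r > N`. -/
theorem integrableOn_inner_div_norm_pow (hN : 2 ≤ N) {p : ℝ≥0∞} (hp : (N : ℝ≥0∞) < p)
    (G : EuclideanSpace ℝ (Fin N) → EuclideanSpace ℝ (Fin N))
    (a y : EuclideanSpace ℝ (Fin N)) (c R : ℝ)
    (hG : ∀ i, MemLp (fun x => G x i) p (volume.restrict (ball a R))) :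
    IntegrableOn (fun x => inner ℝ (G x) (x - y) / (c * ‖x - y‖ ^ N)) (ball a R) := by
  obtain ⟨r, hNr, hrp⟩ := ENNReal.lt_iff_exists_nnreal_btwn.1 hp
  have hNr' : (N : ℝ) < r := by exact_mod_cast hNr
  have hN2 : (2 : ℝ) ≤ N := by exact_mod_cast hN
  have hconj : (r : ℝ).HolderConjugate ((r : ℝ).conjExponent) :=
    Real.HolderConjugate.conjExponent (by linarith)
  have hq : (N - 1 : ℝ) * (r : ℝ).conjExponent < N := by
    rw [Real.conjExponent, ← mul_div_assoc, div_lt_iff₀ (by linarith)]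
    linarith
  have : Fact (volume (ball a R) < ⊤) := ⟨measure_ball_lt_top⟩
  have hsum : (fun x => inner ℝ (G x) (x - y) / (c * ‖x - y‖ ^ N)) =
      fun x => ∑ i, G x i * ((x - y) i / (c * ‖x - y‖ ^ N)) := by
    funext x
    rw [PiLp.inner_apply, Finset.sum_div]
    refine Finset.sum_congr rfl fun i _ => ?_
    simp
    ring
  rw [hsum]
  refine integrable_finsetSum _ fun i _ => ?_
  have hholder : ENNReal.HolderTriple (ENNReal.ofReal r)
      (ENNReal.ofReal (r : ℝ).conjExponent) 1 := by
    have := hconj.ennrealOfReal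
    exact this
  refine MemLp.integrable_mul (p := ENNReal.ofReal r) (q := ENNReal.ofReal (r : ℝ).conjExponent) ?_
    (memLp_coord_div_norm_pow (by omega) i y a c R _ hconj.symm.pos hq)
  refine (hG i).mono_exponent ?_
  rw [ENNReal.ofReal_coe_nnreal]
  exact hrp.le

end Kernel

/-! ### Weak and classical gradients -/

section WeakGradient

variable {N : ℕ}

/-- Against test functions supported in `Ω \ A`, classical integration by parts is available and no
control of `∇f` near `A` is needed; `A` itself is null. -/
theorem IsWeakGradient.ae_eq_gradient {Ω : Set (EuclideanSpace ℝ (Fin N))} {p : ℝ≥0∞}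
    {f : EuclideanSpace ℝ (Fin N) → ℝ} {G : EuclideanSpace ℝ (Fin N) → EuclideanSpace ℝ (Fin N)}
    (hG : IsWeakGradient Ω p f G) (hN : 1 ≤ N) (hp : 1 ≤ p) (hΩ : IsOpen Ω)
    (A : Finset (EuclideanSpace ℝ (Fin N)))
    (hf : ContDiffOn ℝ 1 f (Ω \ (A : Set (EuclideanSpace ℝ (Fin N))))) :
    G =ᵐ[volume.restrict Ω] gradient f := by
  set U := Ω \ (A : Set (EuclideanSpace ℝ (Fin N))) with hU
  have hUo : IsOpen U := hΩ.sdiff A.finite_toSet.isClosed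
  have hdiff : ∀ x ∈ U, DifferentiableAt ℝ f x := fun x hx =>
    (hf.differentiableOn one_ne_zero).differentiableAt (hUo.mem_nhds hx)
  have hfc : ContinuousOn f U := hf.continuousOn
  have hfd : ContinuousOn (fderiv ℝ f) U := hf.continuousOn_fderiv_of_isOpen hUo le_rfl
  have hcoord : ∀ i : Fin N, ∀ᵐ x, x ∈ U →
      G x i - fderiv ℝ f x (EuclideanSpace.single i 1) = 0 := by
    intro i
    have hfdi : ContinuousOn (fun x => fderiv ℝ f x (EuclideanSpace.single i 1)) U :=
      hfd.clm_apply continuousOn_const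
    have hGΩ : LocallyIntegrable (fun x => G x i) (volume.restrict Ω) :=
      (hG.1 i).locallyIntegrable hp
    have hGl : LocallyIntegrableOn (fun x => G x i) U :=
      (locallyIntegrableOn_of_locallyIntegrable_restrict hGΩ).mono_set sdiff_subset
    refine hUo.ae_eq_zero_of_integral_contDiff_smul_eq_zero
      (hGl.sub (hfdi.locallyIntegrableOn hUo.measurableSet)) fun φ hφ hφc hφU => ?_
    -- Continuity of `g` on `U` suffices: the product vanishes off the compact support of `ψ`, which
    -- lies in `U`.
    have hmul : ∀ g : EuclideanSpace ℝ (Fin N) → ℝ, ContinuousOn g U → ∀ ψ : EuclideanSpace ℝ (Fin N) → ℝ,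
        Continuous ψ → tsupport ψ ⊆ tsupport φ → Integrable fun x => g x * ψ x := by
      intro g hg ψ hψ hψs
      have hψc : HasCompactSupport ψ := hφc.of_isClosed_subset (isClosed_tsupport _) hψs
      refine Continuous.integrable_of_hasCompactSupport ?_ hψc.mul_left
      refine continuous_iff_continuousAt.2 fun x => ?_
      by_cases hx : x ∈ tsupport ψ
      · exact (hg.continuousAt (hUo.mem_nhds (hφU (hψs hx)))).mul hψ.continuousAt
      · refine (continuousAt_const (y := (0 : ℝ))).congr ?_
        filter_upwards [(isClosed_tsupport ψ).isOpen_compl.mem_nhds hx] with z hz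
        simp [image_eq_zero_of_notMem_tsupport hz]
    have hφ1 : ContDiff ℝ 1 φ := hφ.of_le (by simp)
    have hφd : Continuous fun x => fderiv ℝ φ x (EuclideanSpace.single i 1) :=
      (hφ1.continuous_fderiv one_ne_zero).clm_apply continuous_const
    have hibp := integral_mul_fderiv_eq_neg_fderiv_mul_of_integrable (μ := volume) (f := f) (g := φ)
      (v := EuclideanSpace.single i 1) (hmul _ hfdi φ hφ.continuous subset_rfl)
      (hmul _ hfc _ hφd (tsupport_fderiv_apply_subset ℝ _)) (hmul _ hfc φ hφ.continuous subset_rfl)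
      (fun x hx => hdiff x (hφU hx)) (fun x _ => (hφ1.differentiable one_ne_zero) x)
    have hweak := hG.2 φ hφ hφc (hφU.trans sdiff_subset) i
    have hsupp : ∀ g ψ : EuclideanSpace ℝ (Fin N) → ℝ, tsupport ψ ⊆ tsupport φ →
        ∫ x in Ω, g x * ψ x = ∫ x, g x * ψ x := by
      intro g ψ hψ
      refine setIntegral_eq_integral_of_forall_compl_eq_zero fun x hx => ?_
      rw [image_eq_zero_of_notMem_tsupport fun h => hx (hφU (hψ h)).1, mul_zero]
    rw [hsupp _ _ (tsupport_fderiv_apply_subset ℝ _), hsupp _ _ subset_rfl, hibp, neg_inj] at hweak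
    have hGφ : Integrable fun x => G x i * φ x := by
      refine (integrableOn_iff_integrable_of_support_subset (s := Ω) fun x hx => ?_).1
        (hGΩ.integrable_smul_right_of_hasCompactSupport hφ.continuous hφc)
      exact (hφU (subset_tsupport φ (right_ne_zero_of_mul hx))).1
    calc ∫ x, φ x • (G x i - fderiv ℝ f x (EuclideanSpace.single i 1))
        = ∫ x, (G x i * φ x - fderiv ℝ f x (EuclideanSpace.single i 1) * φ x) := by
          congr 1; funext x; rw [smul_eq_mul]; ring
      _ = 0 := by
          rw [integral_sub hGφ (hmul _ hfdi φ hφ.continuous subset_rfl), hweak, sub_self]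
  have hA : ∀ᵐ x : EuclideanSpace ℝ (Fin N), x ∉ (A : Set (EuclideanSpace ℝ (Fin N))) := by
    have : Nonempty (Fin N) := ⟨⟨0, hN⟩⟩
    exact measure_eq_zero_iff_ae_notMem.1 (A.finite_toSet.measure_zero volume)
  rw [EventuallyEq, ae_restrict_iff' hΩ.measurableSet]
  filter_upwards [ae_all_iff.2 hcoord, hA] with x hx hxA hxΩ
  ext i
  have h1 := sub_eq_zero.1 (hx i ⟨hxΩ, hxA⟩)
  rw [h1, ← toDual_gradient, InnerProductSpace.toDual_apply_apply,
    EuclideanSpace.inner_single_right]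
  simp

end WeakGradient

/-! ### Surface integrals and segments from `y` -/

section SphereMeasure

variable {N : ℕ}

theorem measurableEmbedding_add_smul_sphere (a : EuclideanSpace ℝ (Fin N)) {R : ℝ} (hR : R ≠ 0) :
    MeasurableEmbedding
      (fun u : sphere (0 : EuclideanSpace ℝ (Fin N)) 1 =>
        a + R • (u : EuclideanSpace ℝ (Fin N))) := by
  refine (Continuous.isClosedEmbedding (by fun_prop) fun u v h => ?_).measurableEmbedding
  exact Subtype.ext (smul_right_injective _ hR (add_left_cancel h))

theorem integrable_sphereMeasure_iff (a : EuclideanSpace ℝ (Fin N)) {R : ℝ} (hR : 0 < R)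
    (g : EuclideanSpace ℝ (Fin N) → ℝ) :
    Integrable g (sphereMeasure a R) ↔
      Integrable (fun u : sphere (0 : EuclideanSpace ℝ (Fin N)) 1 =>
        g (a + R • (u : EuclideanSpace ℝ (Fin N)))) (volume : Measure _).toSphere := by
  have h0 : ENNReal.ofReal (R ^ (N - 1)) ≠ 0 := by
    rw [ne_eq, ENNReal.ofReal_eq_zero, not_le]
    positivity
  rw [sphereMeasure, integrable_smul_measure h0 ENNReal.ofReal_ne_top,
    (measurableEmbedding_add_smul_sphere a hR.ne').integrable_map_iff]
  rfl

theorem integral_sphereMeasure (a : EuclideanSpace ℝ (Fin N)) {R : ℝ} (hR : 0 < R)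
    (g : EuclideanSpace ℝ (Fin N) → ℝ) :
    ∫ x, g x ∂(sphereMeasure a R) =
      R ^ (N - 1) * ∫ u : sphere (0 : EuclideanSpace ℝ (Fin N)) 1,
        g (a + R • (u : EuclideanSpace ℝ (Fin N))) ∂(volume : Measure _).toSphere := by
  rw [sphereMeasure, integral_smul_measure,
    (measurableEmbedding_add_smul_sphere a hR.ne').integral_map,
    ENNReal.toReal_ofReal (by positivity), smul_eq_mul]

theorem poisson_kernel_add_smul {R : ℝ} (hR : 0 < R) (a y : EuclideanSpace ℝ (Fin N)) (t c : ℝ)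
    (v : sphere (0 : EuclideanSpace ℝ (Fin N)) 1) :
    R ^ (N - 1) * (t * inner ℝ (a + R • (v : EuclideanSpace ℝ (Fin N)) - y)
        (a + R • (v : EuclideanSpace ℝ (Fin N)) - a) /
          (R * c * ‖a + R • (v : EuclideanSpace ℝ (Fin N)) - y‖ ^ N)) =
      c⁻¹ * (t * (R ^ (N - 1) * (R - inner ℝ (v : EuclideanSpace ℝ (Fin N)) (y - a)) /
        ‖R • (v : EuclideanSpace ℝ (Fin N)) - (y - a)‖ ^ N)) := by
  have h1 : a + R • (v : EuclideanSpace ℝ (Fin N)) - y = R • (v : EuclideanSpace ℝ (Fin N)) - (y - a) := by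
    abel
  have h2 : inner ℝ (R • (v : EuclideanSpace ℝ (Fin N)) - (y - a))
      (a + R • (v : EuclideanSpace ℝ (Fin N)) - a) =
      R * (R - inner ℝ (v : EuclideanSpace ℝ (Fin N)) (y - a)) := by
    rw [add_sub_cancel_left, inner_sub_left, real_inner_smul_left, real_inner_smul_right,
      real_inner_smul_right, real_inner_self_eq_norm_sq, norm_eq_of_mem_sphere,
      real_inner_comm (v : EuclideanSpace ℝ (Fin N)) (y - a)]
    ring
  rw [h1, h2]
  simp only [div_eq_mul_inv, mul_inv]
  have : R * R⁻¹ = 1 := mul_inv_cancel₀ hR.ne'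
  linear_combination (R ^ (N - 1) * t * (R - inner ℝ (v : EuclideanSpace ℝ (Fin N)) (y - a)) * c⁻¹ *
    (‖R • (v : EuclideanSpace ℝ (Fin N)) - (y - a)‖ ^ N)⁻¹) * this

/-- Differentiability is asked only inside the segment, since `y` may lie in `A` and the far end on
the boundary of `Ω`. -/
theorem integral_segment_eq_sub {E : Type*} [NormedAddCommGroup E] [InnerProductSpace ℝ E]
    [CompleteSpace E] {f : E → ℝ} {y z : E}
    (hc : ContinuousOn (fun s : ℝ => f (y + s • z)) (Icc 0 1))
    (hd : ∀ s ∈ Ioo (0 : ℝ) 1, DifferentiableAt ℝ f (y + s • z))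
    (hi : IntegrableOn (fun s : ℝ => inner ℝ (gradient f (y + s • z)) z) (Ioo 0 1)) :
    ∫ s in Ioo (0 : ℝ) 1, inner ℝ (gradient f (y + s • z)) z = f (y + z) - f y := by
  rw [← integral_Ioc_eq_integral_Ioo, ← intervalIntegral.integral_of_le zero_le_one,
    intervalIntegral.integral_eq_sub_of_hasDerivAt_of_le zero_le_one hc]
  · simp
  · intro s hs
    have h1 : HasDerivAt (fun s : ℝ => y + s • z) z s := by
      simpa using ((hasDerivAt_id s).smul_const z).const_add y
    have h2 := (hd s hs).hasFDerivAt.comp_hasDerivAt s h1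
    rwa [← toDual_gradient, InnerProductSpace.toDual_apply_apply] at h2
  · rwa [intervalIntegrable_iff_integrableOn_Ioo_of_le zero_le_one]

/-- By injectivity of `x ↦ R x - ‖x‖ b`, a given point of `A` lies on the ray of at most one `v`,
and single directions are null. Requiring `s > 0` allows `y ∈ A`. -/
theorem ae_toSphere_forall_segment_notMem (hN : 2 ≤ N) (A : Finset (EuclideanSpace ℝ (Fin N)))
    {R : ℝ} {b : EuclideanSpace ℝ (Fin N)} (hb : ‖b‖ < R) (y : EuclideanSpace ℝ (Fin N)) :
    ∀ᵐ v : sphere (0 : EuclideanSpace ℝ (Fin N)) 1 ∂(volume : Measure _).toSphere,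
      ∀ s : ℝ, 0 < s → y + s • (R • (v : EuclideanSpace ℝ (Fin N)) - b) ∉ A := by
  have hinj := smul_sub_norm_smul_injective hb
  have key : ∀ c ∈ A, ∀ᵐ v : sphere (0 : EuclideanSpace ℝ (Fin N)) 1 ∂(volume : Measure _).toSphere,
      ∀ s : ℝ, 0 < s → y + s • (R • (v : EuclideanSpace ℝ (Fin N)) - b) ≠ c := by
    intro c _
    have hsub : {v : sphere (0 : EuclideanSpace ℝ (Fin N)) 1 | ¬ ∀ s : ℝ, 0 < s →
        y + s • (R • (v : EuclideanSpace ℝ (Fin N)) - b) ≠ c}.Subsingleton := by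
      intro v hv w hw
      simp only [mem_ofPred_eq, not_forall, not_not] at hv hw
      obtain ⟨s, hs, hsv⟩ := hv
      obtain ⟨t, ht, htw⟩ := hw
      have hs' : ‖s • (v : EuclideanSpace ℝ (Fin N))‖ = s := by
        rw [norm_smul, norm_eq_of_mem_sphere, mul_one, Real.norm_of_nonneg hs.le]
      have ht' : ‖t • (w : EuclideanSpace ℝ (Fin N))‖ = t := by
        rw [norm_smul, norm_eq_of_mem_sphere, mul_one, Real.norm_of_nonneg ht.le]
      have heq : s • (v : EuclideanSpace ℝ (Fin N)) = t • (w : EuclideanSpace ℝ (Fin N)) := by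
        apply hinj
        simp only [hs', ht']
        rw [smul_comm R s, smul_comm R t, ← smul_sub, ← smul_sub]
        exact add_left_cancel (hsv.trans htw.symm)
      have hst : s = t := by rw [← hs', ← ht', heq]
      rw [hst] at heq
      exact Subtype.ext (smul_right_injective _ ht.ne' heq)
    rw [ae_iff]
    rcases hsub.eq_empty_or_singleton with h | ⟨v, h⟩
    · rw [h, measure_empty]
    · rw [h]
      exact toSphere_singleton (by simpa using hN) v
  filter_upwards [(A.eventually_all).2 key] with v hv s hs hmem
  exact hv _ hmem s hs rfl

end SphereMeasure

/-! ### The representation formula -/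

theorem corollary1 {N : ℕ} (hN : 2 ≤ N)
    (Ω : Set (EuclideanSpace ℝ (Fin N))) (hΩo : IsOpen Ω) (hΩb : Bornology.IsBounded Ω)
    (hΩs : HasSmoothBoundary Ω)
    (A : Finset (EuclideanSpace ℝ (Fin N))) (hA : (A : Set (EuclideanSpace ℝ (Fin N))) ⊆ Ω)
    (f : EuclideanSpace ℝ (Fin N) → ℝ)
    (hfc : ContinuousOn f (closure Ω))
    (hfd : ContDiffOn ℝ 1 f (Ω \ (A : Set (EuclideanSpace ℝ (Fin N)))))
    (α : ℝ) (hα0 : 0 < α) (hα1 : α < 1) (hH : HolderAtPoints A α f)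
    (p : ℝ≥0∞) (hp : (N : ℝ≥0∞) < p) (hfW : MemW1p Ω p f)
    (a : EuclideanSpace ℝ (Fin N)) (R : ℝ) (hR : 0 < R) (hball : ball a R ⊆ Ω)
    (y : EuclideanSpace ℝ (Fin N)) (hy : y ∈ ball a R) :
    Integrable (fun x => f x * inner ℝ (x - y) (x - a) / (R * unitSphereArea N * ‖x - y‖ ^ N))
      (sphereMeasure a R) ∧
    ∀ G : EuclideanSpace ℝ (Fin N) → EuclideanSpace ℝ (Fin N), IsWeakGradient Ω p f G →
      G =ᵐ[volume.restrict Ω] gradient f ∧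
      IntegrableOn (fun x => inner ℝ (G x) (x - y) / (unitSphereArea N * ‖x - y‖ ^ N))
        (ball a R) ∧
      f y =
        (∫ x, f x * inner ℝ (x - y) (x - a) / (R * unitSphereArea N * ‖x - y‖ ^ N)
          ∂(sphereMeasure a R)) -
        ∫ x in ball a R, inner ℝ (G x) (x - y) / (unitSphereArea N * ‖x - y‖ ^ N) := by
  have hb : ‖y - a‖ < R := mem_ball_iff_norm.1 hy
  set κ := unitSphereArea N with hκ
  have hfin : Module.finrank ℝ (EuclideanSpace ℝ (Fin N)) = N := finrank_euclideanSpace_fin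
  have hd1 : 1 ≤ Module.finrank ℝ (EuclideanSpace ℝ (Fin N)) := by omega
  have hnt : Nontrivial (EuclideanSpace ℝ (Fin N)) :=
    Module.nontrivial_of_finrank_pos (R := ℝ) hd1
  have hκ0 : 0 < κ := by
    rw [hκ, unitSphereArea, measureReal_def]
    exact ENNReal.toReal_pos (mt Measure.measure_univ_eq_zero.1 (Measure.toSphere_ne_zero _))
      (measure_ne_top _ _)
  set W : sphere (0 : EuclideanSpace ℝ (Fin N)) 1 → ℝ := fun v =>
    R ^ (N - 1) * (R - inner ℝ (v : EuclideanSpace ℝ (Fin N)) (y - a)) /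
        ‖R • (v : EuclideanSpace ℝ (Fin N)) - (y - a)‖ ^ N with hW
  have hz0 : ∀ v : sphere (0 : EuclideanSpace ℝ (Fin N)) 1,
      0 < ‖R • (v : EuclideanSpace ℝ (Fin N)) - (y - a)‖ := fun v =>
    (sub_pos.2 hb).trans_le (sub_norm_le_norm_smul_sub hR.le _ v)
  have hWpos : ∀ v, 0 < W v := by
    intro v
    have h1 := real_inner_le_norm (v : EuclideanSpace ℝ (Fin N)) (y - a)
    rw [norm_eq_of_mem_sphere, one_mul] at h1
    have h2 : 0 < R - inner ℝ (v : EuclideanSpace ℝ (Fin N)) (y - a) := by linarith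
    have h3 := hz0 v
    positivity
  have hWc : Continuous W := by
    refine Continuous.div (by fun_prop) (by fun_prop) fun v => (pow_pos (hz0 v) N).ne'
  have hWκ : ∫ v, W v ∂(volume : Measure _).toSphere = κ := by
    have := integral_toSphere_poisson_weight hb hd1
    rwa [hfin] at this
  have hcl : closedBall a R ⊆ closure Ω := by
    rw [← closure_ball a hR.ne']
    exact closure_mono hball
  have hsph : ∀ v : sphere (0 : EuclideanSpace ℝ (Fin N)) 1,
      a + R • (v : EuclideanSpace ℝ (Fin N)) ∈ closedBall a R := by
    intro v
    simp [norm_smul, abs_of_pos hR]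
  have hfS : Continuous fun v : sphere (0 : EuclideanSpace ℝ (Fin N)) 1 =>
      f (a + R • (v : EuclideanSpace ℝ (Fin N))) :=
    hfc.comp_continuous (by fun_prop) fun v => hcl (hsph v)
  have hfWc : Continuous fun v : sphere (0 : EuclideanSpace ℝ (Fin N)) 1 =>
      f (a + R • (v : EuclideanSpace ℝ (Fin N))) * W v := hfS.mul hWc
  have hint : ∀ h : sphere (0 : EuclideanSpace ℝ (Fin N)) 1 → ℝ, Continuous h →
      Integrable h (volume : Measure _).toSphere := fun h hh =>
    hh.integrable_of_hasCompactSupport (HasCompactSupport.of_compactSpace h)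
  have hsurf : ∫ x, f x * inner ℝ (x - y) (x - a) / (R * κ * ‖x - y‖ ^ N) ∂(sphereMeasure a R) =
      κ⁻¹ * ∫ v : sphere (0 : EuclideanSpace ℝ (Fin N)) 1,
        f (a + R • (v : EuclideanSpace ℝ (Fin N))) * W v ∂(volume : Measure _).toSphere := by
    rw [integral_sphereMeasure a hR, ← integral_const_mul, ← integral_const_mul]
    exact integral_congr_ae (ae_of_all _ fun v => poisson_kernel_add_smul hR a y _ κ v)
  refine ⟨?_, fun G hG => ?_⟩
  · rw [integrable_sphereMeasure_iff a hR]
    refine ((hint _ hfWc).const_mul (R ^ (N - 1))⁻¹ |>.const_mul κ⁻¹).congr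
      (ae_of_all _ fun v => ?_)
    have h := poisson_kernel_add_smul hR a y (f (a + R • (v : EuclideanSpace ℝ (Fin N)))) κ v
    change κ⁻¹ * ((R ^ (N - 1))⁻¹ * (f (a + R • (v : EuclideanSpace ℝ (Fin N))) * W v)) = _
    rw [mul_left_comm, ← h, inv_mul_cancel_left₀ (by positivity)]
  have hGae : G =ᵐ[volume.restrict Ω] gradient f :=
    hG.ae_eq_gradient (by omega) (le_trans (by exact_mod_cast (by omega : 1 ≤ N)) hp.le) hΩo A hfd
  have hGint : IntegrableOn (fun x => inner ℝ (G x) (x - y) / (κ * ‖x - y‖ ^ N)) (ball a R) :=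
    integrableOn_inner_div_norm_pow hN hp G a y κ R fun i =>
      (hG.1 i).mono_measure (Measure.restrict_mono hball le_rfl)
  have hcongr : (fun x => inner ℝ (G x) (x - y) / (κ * ‖x - y‖ ^ N)) =ᵐ[volume.restrict (ball a R)]
      fun x => inner ℝ (gradient f x) (x - y) / (κ * ‖x - y‖ ^ N) := by
    filter_upwards [ae_restrict_of_ae_restrict_of_subset hball hGae] with x hx
    rw [hx]
  refine ⟨hGae, hGint, ?_⟩
  obtain ⟨hi, he⟩ := integrable_and_integral_ball_eq_integral_toSphere hb hd1 _ (hGint.congr hcongr)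
  rw [hfin] at hi he
  -- The kernel contributes `s / s^N`, which cancels the Jacobian factor `s^(N-1)`.
  have hpoint : ∀ v : sphere (0 : EuclideanSpace ℝ (Fin N)) 1, ∀ s ∈ Ioo (0 : ℝ) 1,
      s ^ (N - 1) * (R ^ (N - 1) * (R - inner ℝ (v : EuclideanSpace ℝ (Fin N)) (y - a))) *
        (inner ℝ (gradient f (y + s • (R • (v : EuclideanSpace ℝ (Fin N)) - (y - a))))
          (y + s • (R • (v : EuclideanSpace ℝ (Fin N)) - (y - a)) - y) /
          (κ * ‖y + s • (R • (v : EuclideanSpace ℝ (Fin N)) - (y - a)) - y‖ ^ N)) =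
      κ⁻¹ * W v * inner ℝ (gradient f (y + s • (R • (v : EuclideanSpace ℝ (Fin N)) - (y - a))))
        (R • (v : EuclideanSpace ℝ (Fin N)) - (y - a)) := by
    intro v s hs
    have hs0 := hs.1
    have hz := hz0 v
    have hpow : s ^ N = s ^ (N - 1) * s := by rw [← pow_succ]; congr 1; omega
    rw [add_sub_cancel_left, real_inner_smul_right, norm_smul, Real.norm_of_nonneg hs0.le, mul_pow,
      hpow]
    simp only [hW]
    field_simp
  have hmain : ∀ᵐ v : sphere (0 : EuclideanSpace ℝ (Fin N)) 1 ∂(volume : Measure _).toSphere,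
      ∫ s in Ioo (0 : ℝ) 1,
        s ^ (N - 1) * (R ^ (N - 1) * (R - inner ℝ (v : EuclideanSpace ℝ (Fin N)) (y - a))) *
        (inner ℝ (gradient f (y + s • (R • (v : EuclideanSpace ℝ (Fin N)) - (y - a))))
          (y + s • (R • (v : EuclideanSpace ℝ (Fin N)) - (y - a)) - y) /
          (κ * ‖y + s • (R • (v : EuclideanSpace ℝ (Fin N)) - (y - a)) - y‖ ^ N)) =
      κ⁻¹ * (f (a + R • (v : EuclideanSpace ℝ (Fin N))) * W v - f y * W v) := by
    -- Fubini gives integrability of the derivative along almost every segment, as the fundamental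
    -- theorem of calculus requires.
    filter_upwards [hi.prod_right_ae, ae_toSphere_forall_segment_notMem hN A hb y] with v hv hvA
    have hseg : ∀ s : ℝ, y + s • (R • (v : EuclideanSpace ℝ (Fin N)) - (y - a)) =
        (1 - s) • y + s • (a + R • (v : EuclideanSpace ℝ (Fin N))) := fun s => by module
    have hvi : IntegrableOn (fun s : ℝ => inner ℝ
        (gradient f (y + s • (R • (v : EuclideanSpace ℝ (Fin N)) - (y - a))))
        (R • (v : EuclideanSpace ℝ (Fin N)) - (y - a))) (Ioo 0 1) := by
      have h1 := IntegrableOn.congr_fun hv (hpoint v) measurableSet_Ioo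
      have h2 := h1.const_mul (κ⁻¹ * W v)⁻¹
      refine h2.congr (ae_of_all _ fun s => ?_)
      exact inv_mul_cancel_left₀ (mul_pos (inv_pos.2 hκ0) (hWpos v)).ne' _
    have hftc := integral_segment_eq_sub (f := f) (y := y)
      (z := R • (v : EuclideanSpace ℝ (Fin N)) - (y - a)) ?_ ?_ hvi
    · rw [setIntegral_congr_fun measurableSet_Ioo (hpoint v), integral_const_mul, hftc]
      have : y + (R • (v : EuclideanSpace ℝ (Fin N)) - (y - a)) =
        a + R • (v : EuclideanSpace ℝ (Fin N)) := by abel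
      rw [this]
      ring
    · refine hfc.comp (by fun_prop) fun s hs => hcl ?_
      rw [hseg]
      exact convex_closedBall a R (ball_subset_closedBall hy) (hsph v) (by linarith [hs.2]) hs.1
        (by ring)
    · intro s hs
      have hmem : y + s • (R • (v : EuclideanSpace ℝ (Fin N)) - (y - a)) ∈
          Ω \ (A : Set (EuclideanSpace ℝ (Fin N))) := by
        refine ⟨hball ?_, hvA s hs.1⟩
        rw [hseg, ← interior_closedBall a hR.ne']
        -- An open segment from an interior point to a point of the closed ball stays in the
        -- interior, even if the sphere touches the boundary of `Ω`.
        exact (convex_closedBall a R).combo_interior_closure_mem_interior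
          (by rwa [interior_closedBall a hR.ne']) (subset_closure (hsph v))
          (by linarith [hs.2]) hs.1.le (by ring)
      exact (hfd.differentiableOn one_ne_zero).differentiableAt
        ((hΩo.sdiff A.finite_toSet.isClosed).mem_nhds hmem)
  rw [integral_congr_ae hcongr, he, integral_prod _ hi, integral_congr_ae hmain,
    integral_const_mul, integral_sub (hint _ hfWc) (hint _ (hWc.const_mul _)),
    integral_const_mul, hWκ, hsurf]
  field_simp
  ring
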